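/- **Conventions.** Let $K$ be a commutative non-Archimedean Banach ring (complete, $\|ab\|\le\|a\|\|b\|$, $\|a+b\|\le\max(\|a\|,\|b\|)$), torsion free as an abelian group. A Banach $K$-module is a $K$-module $V$ that is complete for an ultrametric norm with $\|\lambda v\|\le\|\lambda\|\,\|v\|$; $\mathrm{End}(V)$ denotes the Banach $K$-algebra of bounded $K$-linear operators on $V$ with the operator norm. A *field* on $V$ is a formal series $a(z)=\sum_{n\in\mathbb Z}a_{(n)}z^{-n-1}$ with $a_{(n)}\in\mathrm{End}(V)$, $\|a(z)\|:=\sup_n\|a_{(n)}\|<\infty$, and $a_{(n)}v\to0$ as $n\to+\infty$ for every $v\in V$; fields form the Banach $K$-module $\mathrm{End}(V)\langle\langle z\rangle\rangle$. Put $\partial_z^{(i)}\sum_n v_nz^n=\sum_n\binom ni v_nz^{n-i}$, $a(z)_+=\sum_{n\le-1}a_{(n)}z^{-n-1}$, $a(z)_-=\sum_{n\ge0}a_{(n)}z^{-n-1}$ and ${:}a(z)b(z){:}=a(z)_+b(z)+b(z)a(z)_-$ (the coefficients being sums that converge on every vector). The $n$-th product of fields is $a(w)_{(n)}b(w)=\mathrm{Res}_z\big((z-w)^n[a(z),b(w)]\big)$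 for $n\ge0$, and $a(z)_{(-m-1)}b(z)={:}(\partial_z^{(m)}a(z))\,b(z){:}$ for $m\ge0$. Fields $a(z),b(z)$ are mutually local if $(z-w)^N[a(z),b(w)]\to0$ in the supremum norm as $N\to\infty$. A *vertex $K$-algebra* consists of a Banach $K$-module $V$ that is torsion free as an abelian group and as a $K$-module ($\lambda v=0$ implies $\lambda=0$ or $v=0$), a vector $|0\rangle\in V$, a bounded $K$-linear operator $T$ on $V$ with $T|0\rangle=0$, and a closed $K$-submodule $\mathrm{Fld}(V)\subset\mathrm{End}(V)\langle\langle z\rangle\rangle$ containing the identity operator, such that: (1) $\varphi_{(n)}|0\rangle=0$ for all $\varphi(z)\in\mathrm{Fld}(V)$, $n\ge0$; (2) $[T,\varphi(z)]=\partial_z\varphi(z)$ for all $\varphi(z)\in\mathrm{Fld}(V)$; (3) all fields in $\mathrm{Fld}(V)$ are mutually local; (4) $\mathrm{Fld}(V)$ is preserved by all $n$-th products, $n\in\mathbb Z$; (5) if $V'$ is the image of $fs:\mathrm{Fld}(V)\to V$, $\varphi(z)\mapsto\varphi_{(-1)}|0\rangle$, then $\{v\in V: \lambda v\in V'\text{ for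 some }0\ne\lambda\in K\}$ is dense in $V$. The map $fs$ is injective; write $a\mapsto Y(a,z)=\sum_n a_{(n)}z^{-n-1}$ for the inverse bijection $V'\to\mathrm{Fld}(V)$. For $a,b\in V'$ one has $a_{(n)}b\in V'$. For $m\ge0$ and $a\in V'$ let $T^{(m)}a=a_{(-m-1)}|0\rangle$; it lies in $V'$ and is the unique element with $m!\,T^{(m)}a=T^ma$. Put $e^{zT}a=\sum_{m\ge0}z^m\,T^{(m)}a$, and extend $e^{zT}$ to formal series with coefficients in $V'$ coefficientwise. Finally $i_{z,w}$ denotes expansion in the domain $|z|>|w|$: $i_{z,w}Y(a,z+w)b=\sum_n a_{(n)}b\sum_{q\ge0}\binom{-n-1}{q}z^{-n-1-q}w^q$. **Statement.** Let $V$ be a vertex $K$-algebra. (a) For all $a,b\in V'$, as formal series in $z^{\pm1},w$ with coefficients in $V'$, $$e^{wT}\,Y(a,z)\,e^{-wT}\,b=i_{z,w}\,Y(a,z+w)\,b .$$ (b) (Skew-symmetry) For all $a,b\in V'$, $$Y(a,z)b=e^{zT}\,Y(b,-z)a ,$$ where each coefficient of the right-hand side is a convergent series in $V$. (c) For all $a,b\in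 V'$ and $n\in\mathbb Z$, $$a_{(n)}b=-\sum_{m=0}^{\infty}(-1)^{m+n}\,T^{(m)}\big(b_{(m+n)}a\big),$$ the series converging in $V$. (d) For all $a(z),b(z)\in\mathrm{Fld}(V)$ and $n\in\mathbb Z$, $$a(z)_{(n)}b(z)=-\sum_{m=0}^{\infty}(-1)^{m+n}\,\partial_z^{(m)}\big(b(z)_{(m+n)}a(z)\big),$$ the series converging in norm in the Banach module $\mathrm{End}(V)\langle\langle z\rangle\rangle$. -/

import Mathlib

open Filter Topology

namespace NAVertex

section Fields

set_option linter.unusedSectionVars false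

variable {K V : Type*} [NormedCommRing K] [IsUltrametricDist K] [CompleteSpace K]
  [NormedAddCommGroup V] [IsUltrametricDist V] [CompleteSpace V] [Module K V] [IsBoundedSMul K V]

/-- For a family of `K`-linear operators `X i` on `V` and `C ≥ 0`: every `X i` is bounded and
`sup_i ‖X i‖ ≤ C` (`‖·‖` being the operator norm).  For `ι = ℤ`, resp. `ι = ℤ × ℤ`, this says that
the norm of the formal distribution in one, resp. two, variables with coefficients `X i`
is at most `C`. -/
def NormLE {ι : Type*} (X : ι → Module.End K V) (C : ℝ) : Prop :=
  ∀ i v, ‖X i v‖ ≤ C * ‖v‖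

variable (K V) in
/-- The `K`-module `End(V)⟨⟨z⟩⟩` of `End(V)`-valued quantum fields.
A field `a(z) = ∑ a_(n) z^(-n-1)` is represented by the function `n ↦ a_(n)`; the operators `a_(n)`
are uniformly bounded, and `a_(n) v → 0` as `n → +∞` for every `v`. -/
def QField : Submodule K (ℤ → Module.End K V) where
  carrier := {φ | (∃ C, NormLE φ C) ∧ ∀ v, Tendsto (fun n => φ n v) atTop (𝓝 0)}
  zero_mem' := ⟨⟨0, fun i v => by simp⟩, fun v => by simp⟩
  add_mem' := by
    rintro φ ψ ⟨⟨C, hC⟩, hφ⟩ ⟨⟨D, hD⟩, hψ⟩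
    refine ⟨⟨C + D, fun n v => ?_⟩, fun v => ?_⟩
    · calc ‖φ n v + ψ n v‖ ≤ ‖φ n v‖ + ‖ψ n v‖ := norm_add_le _ _
        _ ≤ C * ‖v‖ + D * ‖v‖ := add_le_add (hC n v) (hD n v)
        _ = (C + D) * ‖v‖ := by ring
    · simpa using (hφ v).add (hψ v)
  smul_mem' := by
    rintro c φ ⟨⟨C, hC⟩, hφ⟩
    refine ⟨⟨‖c‖ * C, fun n v => ?_⟩, fun v => ?_⟩
    · calc ‖c • φ n v‖ ≤ ‖c‖ * ‖φ n v‖ := norm_smul_le _ _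
        _ ≤ ‖c‖ * (C * ‖v‖) := by gcongr; exact hC n v
        _ = (‖c‖ * C) * ‖v‖ := by ring
    · simpa using (hφ v).const_smul c

theorem exists_bound (φ : QField K V) : ∃ C, 0 ≤ C ∧ NormLE φ.1 C := by
  obtain ⟨C, hC⟩ := φ.2.1
  exact ⟨max C 0, le_max_right _ _, fun n v => (hC n v).trans
    (mul_le_mul_of_nonneg_right (le_max_left _ _) (norm_nonneg v))⟩

theorem field_tendsto (φ : QField K V) (v : V) : Tendsto (fun n => φ.1 n v) atTop (𝓝 0) :=
  φ.2.2 v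

theorem tendsto_zero_of_le {f : ℤ → V} {g : ℤ → V} {C : ℝ}
    (h : ∀ n, ‖f n‖ ≤ C * ‖g n‖) (hg : Tendsto g atTop (𝓝 0)) : Tendsto f atTop (𝓝 0) := by
  have : Tendsto (fun n => C * ‖g n‖) atTop (𝓝 0) := by
    simpa using (tendsto_zero_iff_norm_tendsto_zero.1 hg).const_mul C
  exact squeeze_zero_norm h this

theorem norm_zsmul_le_self (n : ℤ) (v : V) : ‖n • v‖ ≤ ‖v‖ :=
  IsUltrametricDist.norm_zsmul_le v n

theorem norm_sub_le_max' (u v : V) : ‖u - v‖ ≤ max ‖u‖ ‖v‖ := by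
  simpa [sub_eq_add_neg] using IsUltrametricDist.norm_add_le_max u (-v)

variable (K V) in
/-- The field `I_V` (the identity operator, as a constant distribution). -/
def idField : QField K V :=
  ⟨fun n => if n = -1 then 1 else 0, by
    refine ⟨⟨1, fun n v => ?_⟩, fun v => ?_⟩
    · by_cases h : n = -1 <;> simp [h]
    · refine tendsto_const_nhds.congr' ?_
      filter_upwards [eventually_ge_atTop (0 : ℤ)] with n hn
      have : n ≠ -1 := by omega
      simp [this]⟩

/-- The divided-power derivative `∂_z^(i)`, `∂_z^(i) (∑ v_n z^n) = ∑ binom(n,i) v_n z^(n-i)`, on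
distributions written as `∑ a_(n) z^(-n-1)`. -/
def hderiv (i : ℕ) (φ : QField K V) : QField K V :=
  ⟨fun p => (Ring.choose ((i : ℤ) - p - 1) i : ℤ) • φ.1 (p - i), by
    obtain ⟨C, -, hC⟩ := exists_bound φ
    refine ⟨⟨C, fun p v => ?_⟩, fun v => ?_⟩
    · exact (norm_zsmul_le_self _ _).trans (hC _ _)
    · refine tendsto_zero_of_le (g := fun p => φ.1 (p - i) v) (C := 1) (fun p => ?_)
        ((field_tendsto φ v).comp (tendsto_atTop_add_const_right _ (-(i : ℤ)) tendsto_id))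
      rw [one_mul]
      exact norm_zsmul_le_self _ _⟩

/-- `[a(z), b(w)]`: the family of the coefficients `[a_(m), b_(n)]` at `z^(-m-1) w^(-n-1)`. -/
def comm (φ ψ : ℤ → Module.End K V) : ℤ → ℤ → Module.End K V :=
  fun m n => φ m * ψ n - ψ n * φ m

/-- Multiplication of `F(z,w) = ∑ F_(m,n) z^(-m-1) w^(-n-1)` by `z - w`. -/
def mulSub (F : ℤ → ℤ → Module.End K V) : ℤ → ℤ → Module.End K V :=
  fun m n => F (m + 1) n - F m (n + 1)

/-- Mutual locality: `(z-w)^N [a(z), b(w)] → 0` as `N → ∞`, in the norm of `End(V)[[z^±1,w^±1]]`. -/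
def IsLocal (φ ψ : ℤ → Module.End K V) : Prop :=
  ∀ ε > 0, ∃ N₀ : ℕ, ∀ N ≥ N₀,
    NormLE (fun p : ℤ × ℤ => (mulSub^[N] (comm φ ψ)) p.1 p.2) ε

theorem iterate_mulSub_bound {F : ℤ → ℤ → Module.End K V} {C : ℝ}
    (hF : ∀ m n v, ‖F m n v‖ ≤ C * ‖v‖) (N : ℕ) :
    ∀ m n v, ‖(mulSub^[N] F) m n v‖ ≤ C * ‖v‖ := by
  induction N generalizing F with
  | zero => simpa using hF
  | succ N ih =>
    rw [Function.iterate_succ_apply]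
    refine ih (fun m n v => ?_)
    exact (norm_sub_le_max' _ _).trans (max_le (hF _ _ _) (hF _ _ _))

theorem iterate_mulSub_tendsto {F : ℤ → ℤ → Module.End K V}
    (hF : ∀ m v, Tendsto (fun n => F m n v) atTop (𝓝 0)) (N : ℕ) :
    ∀ m v, Tendsto (fun n => (mulSub^[N] F) m n v) atTop (𝓝 0) := by
  induction N generalizing F with
  | zero => simpa using hF
  | succ N ih =>
    rw [Function.iterate_succ_apply]
    refine ih (fun m v => ?_)
    simpa [mulSub] using (hF (m + 1) v).sub
      ((hF m v).comp (tendsto_atTop_add_const_right _ (1 : ℤ) tendsto_id))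

theorem iterate_mulSub_vac {F : ℤ → ℤ → Module.End K V} {x : V}
    (hF : ∀ m n, 0 ≤ n → F m n x = 0) (N : ℕ) :
    ∀ m, (mulSub^[N] F) m (-1) x = F (m + N) (-1) x := by
  induction N generalizing F with
  | zero => simp
  | succ N ih =>
    intro m
    rw [Function.iterate_succ_apply, ih]
    · have h0 : F (m + N) (-1 + 1) x = 0 := hF _ _ (by norm_num)
      simp only [mulSub, LinearMap.sub_apply, h0, sub_zero]
      push_cast
      rw [add_assoc]
    · intro m n hn
      simp [mulSub, hF _ n hn, hF m (n + 1) (by omega)]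

theorem summable_of_tendsto {f : ℕ → V} (hf : Tendsto f atTop (𝓝 0)) : Summable f := by
  apply NonarchimedeanAddGroup.summable_of_tendsto_cofinite_zero
  rwa [Nat.cofinite_eq_atTop]

theorem summable_plus (φ ψ : QField K V) (p : ℤ) (v : V) :
    Summable fun k : ℕ => φ.1 (-1 - k) (ψ.1 (p + k) v) := by
  obtain ⟨C, hC0, hC⟩ := exists_bound φ
  apply summable_of_tendsto
  have h1 : Tendsto (fun k : ℕ => p + (k : ℤ)) atTop atTop :=
    tendsto_atTop_add_const_left _ _ tendsto_natCast_atTop_atTop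
  have h2 := ((tendsto_zero_iff_norm_tendsto_zero.1 ((field_tendsto ψ v).comp h1))).const_mul C
  rw [mul_zero] at h2
  exact squeeze_zero_norm (fun k => hC _ _) h2

theorem summable_minus (φ ψ : QField K V) (p : ℤ) (v : V) :
    Summable fun k : ℕ => ψ.1 (p - 1 - k) (φ.1 k v) := by
  obtain ⟨C, hC0, hC⟩ := exists_bound ψ
  apply summable_of_tendsto
  have h2 := ((tendsto_zero_iff_norm_tendsto_zero.1
    ((field_tendsto φ v).comp tendsto_natCast_atTop_atTop))).const_mul C
  rw [mul_zero] at h2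
  exact squeeze_zero_norm (fun k => hC _ _) h2

theorem norm_tsum_le_of_le {f : ℕ → V} {C : ℝ} (h : ∀ k, ‖f k‖ ≤ C) : ‖∑' k, f k‖ ≤ C :=
  IsUltrametricDist.norm_tsum_le_of_forall_le h

/-- The normally ordered product `:a(z)b(z): = a(z)_+ b(z) + b(z) a(z)_-`, where
`a(z)_+ = ∑_{n ≤ -1} a_(n) z^(-n-1)` and `a(z)_- = ∑_{n ≥ 0} a_(n) z^(-n-1)`.
Its coefficient at `z^(-p-1)` is
`∑_{m+n=p-1, m ≤ -1} a_(m) b_(n) + ∑_{m+n=p-1, m ≥ 0} b_(n) a_(m)`;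
both sums converge at every vector. -/
noncomputable def normalOrd (φ ψ : QField K V) : QField K V :=
  ⟨fun p =>
    { toFun := fun v =>
        (∑' k : ℕ, φ.1 (-1 - k) (ψ.1 (p + k) v)) + ∑' k : ℕ, ψ.1 (p - 1 - k) (φ.1 k v)
      map_add' := fun u v => by
        simp only [map_add]
        rw [(summable_plus φ ψ p u).tsum_add (summable_plus φ ψ p v),
          (summable_minus φ ψ p u).tsum_add (summable_minus φ ψ p v)]
        abel
      map_smul' := fun c v => by
        simp only [map_smul, RingHom.id_apply]
        rw [(summable_plus φ ψ p v).tsum_const_smul c,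
          (summable_minus φ ψ p v).tsum_const_smul c, smul_add] }, by
    obtain ⟨C, hC0, hC⟩ := exists_bound φ
    obtain ⟨D, hD0, hD⟩ := exists_bound ψ
    refine ⟨⟨C * D, fun p v => ?_⟩, fun v => ?_⟩
    · refine (IsUltrametricDist.norm_add_le_max _ _).trans (max_le ?_ ?_)
      · refine norm_tsum_le_of_le fun k => ?_
        calc _ ≤ C * ‖ψ.1 (p + k) v‖ := hC _ _
          _ ≤ C * (D * ‖v‖) := by gcongr; exact hD _ _
          _ = C * D * ‖v‖ := by ring
      · refine norm_tsum_le_of_le fun k => ?_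
        calc _ ≤ D * ‖φ.1 k v‖ := hD _ _
          _ ≤ D * (C * ‖v‖) := by gcongr; exact hC _ _
          _ = C * D * ‖v‖ := by ring
    · rw [NormedAddGroup.tendsto_nhds_zero]
      intro ε hε
      have hψ := (NormedAddGroup.tendsto_nhds_zero.1 (field_tendsto ψ v)) (ε / 2 / (C + 1))
        (by positivity)
      have hφ := (NormedAddGroup.tendsto_nhds_zero.1
        ((field_tendsto φ v).comp tendsto_natCast_atTop_atTop)) (ε / 2 / (D + 1)) (by positivity)
      obtain ⟨P, hP⟩ := eventually_atTop.1 hψ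
      obtain ⟨k₀, hk₀⟩ := eventually_atTop.1 hφ
      have hfin : ∀ᶠ p : ℤ in atTop, ∀ k ∈ Finset.range k₀,
          ‖ψ.1 (p - 1 - (k : ℤ)) (φ.1 k v)‖ < ε / 2 := by
        rw [Filter.eventually_all_finset]
        intro k _
        have ht : Tendsto (fun p : ℤ => p - 1 - (k : ℤ)) atTop atTop := by
          have := tendsto_atTop_add_const_right atTop (-1 - (k : ℤ)) (tendsto_id (α := ℤ))
          refine this.congr fun p => ?_
          simp only [id]; ring
        exact NormedAddGroup.tendsto_nhds_zero.1 ((field_tendsto ψ _).comp ht) _ (by positivity)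
      have key : ∀ {A B x : ℝ}, 0 ≤ A → 0 ≤ x → B ≤ A * x → x < ε / 2 / (A + 1) → B ≤ ε / 2 := by
        intro A B x hA hx hB hlt
        rw [lt_div_iff₀ (by positivity)] at hlt
        nlinarith
      filter_upwards [hfin, eventually_ge_atTop P] with p hp hpP
      refine lt_of_le_of_lt (b := ε / 2) ?_ (by linarith)
      refine (IsUltrametricDist.norm_add_le_max _ _).trans (max_le ?_ ?_)
      · exact norm_tsum_le_of_le fun k =>
          key hC0 (norm_nonneg _) (hC _ _) (hP (p + k) (by omega))
      · refine norm_tsum_le_of_le fun k => ?_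
        by_cases hk : k < k₀
        · exact (hp k (Finset.mem_range.2 hk)).le
        · exact key hD0 (norm_nonneg _) (hD _ _) (hk₀ k (not_lt.1 hk))⟩

/-- For `n ≥ 0`, the `n`-th product `a(w)_(n) b(w) = Res_z ((z-w)^n [a(z), b(w)])`
(`Res_z` is the coefficient at `z^(-1)`). -/
def resProd (φ ψ : QField K V) (n : ℕ) : QField K V :=
  ⟨fun p => (mulSub^[n] (comm φ.1 ψ.1)) 0 p, by
    obtain ⟨C, hC0, hC⟩ := exists_bound φ
    obtain ⟨D, hD0, hD⟩ := exists_bound ψ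
    have hb : ∀ m n v, ‖comm φ.1 ψ.1 m n v‖ ≤ (C * D) * ‖v‖ := by
      intro m n v
      refine (norm_sub_le_max' _ _).trans (max_le ?_ ?_)
      · calc _ ≤ C * ‖ψ.1 n v‖ := hC _ _
          _ ≤ C * (D * ‖v‖) := by gcongr; exact hD _ _
          _ = C * D * ‖v‖ := by ring
      · calc _ ≤ D * ‖φ.1 m v‖ := hD _ _
          _ ≤ D * (C * ‖v‖) := by gcongr; exact hC _ _
          _ = C * D * ‖v‖ := by ring
    have ht : ∀ m v, Tendsto (fun n => comm φ.1 ψ.1 m n v) atTop (𝓝 0) := by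
      intro m v
      have h1 : Tendsto (fun n => φ.1 m (ψ.1 n v)) atTop (𝓝 0) :=
        tendsto_zero_of_le (fun n => hC m _) (field_tendsto ψ v)
      simpa [comm] using h1.sub (field_tendsto ψ (φ.1 m v))
    exact ⟨⟨C * D, fun p v => iterate_mulSub_bound hb n 0 p v⟩,
      fun v => iterate_mulSub_tendsto ht n 0 v⟩⟩

/-- The `n`-th product `a(z)_(n) b(z)` of fields, `n ∈ ℤ`; for `n = -m-1 < 0` it is
`:(∂_z^(m) a(z)) b(z):`. -/
noncomputable def nthProd (φ ψ : QField K V) : ℤ → QField K V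
  | Int.ofNat n => resProd φ ψ n
  | Int.negSucc m => normalOrd (hderiv m φ) ψ

/-- `a(z)` is translation covariant: `[T, a(z)] = ∂_z a(z)`. -/
def IsCovariant (T : Module.End K V) (φ : QField K V) : Prop :=
  ∀ n, T * φ.1 n - φ.1 n * T = (hderiv 1 φ).1 n

/-- The series `∑_{m ≥ 0} f m` converges to `g` in the Banach `K`-module `End(V)⟨⟨z⟩⟩`. -/
def FieldHasSum (f : ℕ → QField K V) (g : QField K V) : Prop :=
  ∀ ε > 0, ∃ M₀ : ℕ, ∀ M ≥ M₀, NormLE (g - ∑ m ∈ Finset.range M, f m).1 ε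

theorem hderiv_apply_neg_one (m : ℕ) (φ : QField K V) :
    (hderiv m φ).1 (-1) = φ.1 (-(m : ℤ) - 1) := by
  have h1 : ((m : ℤ) - (-1) - 1) = ((m : ℕ) : ℤ) := by ring
  have h2 : (-1 - (m : ℤ)) = -(m : ℤ) - 1 := by ring
  simp [hderiv, h2, Ring.choose_natCast]

theorem normalOrd_idField (φ : QField K V) : normalOrd φ (idField K V) = φ := by
  apply Subtype.ext
  funext p
  apply LinearMap.ext
  intro v
  change (∑' k : ℕ, φ.1 (-1 - k) ((idField K V).1 (p + k) v)) +
    ∑' k : ℕ, (idField K V).1 (p - 1 - k) (φ.1 k v) = φ.1 p v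
  rcases lt_or_ge p 0 with hp | hp
  · obtain ⟨k, rfl⟩ : ∃ k : ℕ, p = -1 - k := ⟨(-1 - p).toNat, by omega⟩
    rw [tsum_eq_single k, tsum_eq_single 0]
    · have : ¬ (-1 - (k : ℤ) - 1 = -1) := by omega
      simp [idField, this]
    · intro j _
      have : ¬ (-1 - (k : ℤ) - 1 - j = -1) := by omega
      simp [idField, this]
    · intro j hj
      have : ¬ (-1 - (k : ℤ) + j = -1) := by omega
      simp [idField, this]
  · obtain ⟨k, rfl⟩ : ∃ k : ℕ, p = k := ⟨p.toNat, by omega⟩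
    rw [tsum_eq_single 0, tsum_eq_single k]
    · have : ¬ ((k : ℤ) = -1) := by omega
      simp [idField, this]
    · intro j hj
      have : ¬ ((k : ℤ) - 1 - j = -1) := by omega
      simp [idField, this]
    · intro j _
      have : ¬ ((k : ℤ) + j = -1) := by omega
      simp [idField, this]

end Fields

/-- A (non-Archimedean) vertex `K`-algebra with space of states `V`. -/
structure VertexAlgebra (K V : Type*) [NormedCommRing K] [IsUltrametricDist K] [CompleteSpace K]
    [IsAddTorsionFree K] [NormedAddCommGroup V] [IsUltrametricDist V] [CompleteSpace V]
    [Module K V] [IsBoundedSMul K V] [IsAddTorsionFree V] where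
  /-- `V` is a torsion free `K`-module -/
  torsionFree : ∀ (c : K) (v : V), c • v = 0 → c = 0 ∨ v = 0
  /-- the vacuum vector `|0⟩` -/
  vac : V
  /-- the translation operator -/
  T : Module.End K V
  T_bounded : ∃ C : ℝ, ∀ v, ‖T v‖ ≤ C * ‖v‖
  T_vac : T vac = 0
  /-- the space of fields `Fld(V)` -/
  Fld : Submodule K (QField K V)
  isClosed_Fld : ∀ φ : QField K V, (∀ ε > 0, ∃ ψ ∈ Fld, NormLE (φ - ψ).1 ε) → φ ∈ Fld
  id_mem : idField K V ∈ Fld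
  /-- `φ(z)|0⟩ ∈ V[[z]]` -/
  vacuum : ∀ φ ∈ Fld, ∀ n : ℤ, 0 ≤ n → φ.1 n vac = 0
  covariant : ∀ φ ∈ Fld, IsCovariant T φ
  locality : ∀ φ ∈ Fld, ∀ ψ ∈ Fld, IsLocal φ.1 ψ.1
  nthProd_mem : ∀ φ ∈ Fld, ∀ ψ ∈ Fld, ∀ n : ℤ, nthProd φ ψ n ∈ Fld
  /-- the `K`-saturation of the image of `φ(z) ↦ φ_(-1)|0⟩` is dense -/
  dense_saturation : Dense {v : V | ∃ c : K, c ≠ 0 ∧ ∃ φ ∈ Fld, φ.1 (-1) vac = c • v}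

namespace VertexAlgebra

variable {K V : Type*} [NormedCommRing K] [IsUltrametricDist K] [CompleteSpace K]
  [IsAddTorsionFree K] [NormedAddCommGroup V] [IsUltrametricDist V] [CompleteSpace V]
  [Module K V] [IsBoundedSMul K V] [IsAddTorsionFree V] (A : VertexAlgebra K V)

/-- The field-state homomorphism `fs : Fld(V) → V`, `φ(z) ↦ φ_(-1)|0⟩`. -/
def fs : A.Fld →ₗ[K] V where
  toFun φ := φ.1.1 (-1) A.vac
  map_add' _ _ := rfl
  map_smul' _ _ := rfl

/-- The image `V'` of the field-state homomorphism. -/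
def states : Submodule K V := LinearMap.range A.fs

theorem T_mode_vac (φ : A.Fld) (n : ℤ) :
    A.T (φ.1.1 n A.vac) = (-n) • φ.1.1 (n - 1) A.vac := by
  have h := LinearMap.congr_fun (A.covariant φ.1 φ.2 n) A.vac
  have h1 : ((1 : ℕ) : ℤ) - n - 1 = -n := by push_cast; ring
  simpa [hderiv, A.T_vac, Ring.choose_one_right] using h

/-- `T^m (φ_(-1)|0⟩) = m! φ_(-m-1)|0⟩`. -/
theorem T_pow_fs (φ : A.Fld) (m : ℕ) :
    (A.T ^ m) (φ.1.1 (-1) A.vac) = m.factorial • φ.1.1 (-(m : ℤ) - 1) A.vac := by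
  induction m with
  | zero => simp
  | succ m ih =>
    rw [pow_succ', Module.End.mul_apply, ih, map_nsmul, A.T_mode_vac]
    have h1 : -(m : ℤ) - 1 - 1 = -((m + 1 : ℕ) : ℤ) - 1 := by push_cast; ring
    have h2 : -(-(m : ℤ) - 1) = ((m + 1 : ℕ) : ℤ) := by push_cast; ring
    rw [h1, h2, natCast_zsmul, smul_smul, Nat.factorial_succ, mul_comm]

theorem fs_injective : Function.Injective A.fs := by
  rw [injective_iff_map_eq_zero]
  intro φ h
  have h1 : ∀ n : ℤ, φ.1.1 n A.vac = 0 := by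
    intro n
    rcases lt_or_ge n 0 with hn | hn
    · obtain ⟨m, rfl⟩ : ∃ m : ℕ, n = -(m : ℤ) - 1 := ⟨(-1 - n).toNat, by omega⟩
      have h2 := A.T_pow_fs φ m
      rw [show φ.1.1 (-1) A.vac = 0 from h, map_zero] at h2
      exact (IsAddTorsionFree.nsmul_right_injective (Nat.factorial_ne_zero m))
        (by simpa using h2.symm)
    · exact A.vacuum φ.1 φ.2 n hn
  have h3 : ∀ ψ ∈ A.Fld, ∀ p : ℤ, φ.1.1 p (ψ.1 (-1) A.vac) = 0 := by
    intro ψ hψ p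
    rw [← norm_le_zero_iff]
    have hF : ∀ m n : ℤ, 0 ≤ n → comm φ.1.1 ψ.1 m n A.vac = 0 := by
      intro m n hn
      simp [comm, h1, A.vacuum ψ hψ n hn]
    have hle : ∀ ε > 0, ‖φ.1.1 p (ψ.1 (-1) A.vac)‖ ≤ ε * ‖A.vac‖ := by
      intro ε hε
      obtain ⟨N, hN⟩ := A.locality φ.1 φ.2 ψ hψ ε hε
      have h4 := hN N le_rfl (p - N, -1) A.vac
      rw [iterate_mulSub_vac hF] at h4
      simpa [comm, h1] using h4
    refine le_of_forall_pos_le_add fun ε hε => ?_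
    refine (hle (ε / (‖A.vac‖ + 1)) (by positivity)).trans ?_
    rw [zero_add, div_mul_eq_mul_div, div_le_iff₀ (by positivity)]
    nlinarith [norm_nonneg A.vac]
  apply Subtype.ext
  apply Subtype.ext
  funext p
  apply LinearMap.ext
  intro v
  obtain ⟨C, hC0, hC⟩ := exists_bound φ.1
  have hcont : Continuous (φ.1.1 p) :=
    AddMonoidHomClass.continuous_of_bound (φ.1.1 p) C (hC p)
  have := hcont.ext_on A.dense_saturation continuous_zero (f := φ.1.1 p) (g := 0) ?_
  · exact congrFun this v
  · rintro x ⟨c, hc, ψ, hψ, hx⟩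
    have h5 := h3 ψ hψ p
    rw [hx, map_smul] at h5
    exact (A.torsionFree c _ h5).resolve_left hc

/-- The state-field correspondence `sf : V' → Fld(V)`, `a ↦ Y(a,z)`, inverse to `fs`. -/
noncomputable def Y : A.states ≃ₗ[K] A.Fld := (LinearEquiv.ofInjective A.fs A.fs_injective).symm

theorem fs_Y (a : A.states) : (A.Y a).1.1 (-1) A.vac = a :=
  congrArg Subtype.val ((LinearEquiv.ofInjective A.fs A.fs_injective).apply_symm_apply a)

theorem hderiv_mem {φ : QField K V} (hφ : φ ∈ A.Fld) (m : ℕ) : hderiv m φ ∈ A.Fld := by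
  have h := A.nthProd_mem φ hφ _ A.id_mem (Int.negSucc m)
  simpa only [nthProd, normalOrd_idField] using h

/-- The operator `T^(m) = (1/m!) T^m` on `V'`: `T^(m) a = a_(-m-1)|0⟩`.  See
`factorial_smul_divT`; as `V` has no additive torsion, `T^(m) a` is the only element `x` with
`m! x = T^m a`. -/
noncomputable def divT (m : ℕ) : A.states →ₗ[K] A.states :=
  LinearMap.codRestrict A.states
    { toFun := fun a => (A.Y a).1.1 (-(m : ℤ) - 1) A.vac
      map_add' := fun a b => by simp
      map_smul' := fun c a => by simp }
    (fun a => ⟨⟨hderiv m (A.Y a).1, A.hderiv_mem (A.Y a).2 m⟩,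
      LinearMap.congr_fun (hderiv_apply_neg_one m (A.Y a).1) A.vac⟩)

theorem factorial_smul_divT (m : ℕ) (a : A.states) :
    m.factorial • (A.divT m a : V) = (A.T ^ m) a := by
  rw [← A.fs_Y a, A.T_pow_fs]
  rfl

/-- `(φ(z)_(n) ψ(z))_(-1)|0⟩ = φ_(n) (ψ_(-1)|0⟩)`. -/
theorem nthProd_vac {φ ψ : QField K V} (hφ : φ ∈ A.Fld) (hψ : ψ ∈ A.Fld) (n : ℤ) :
    (nthProd φ ψ n).1 (-1) A.vac = φ.1 n (ψ.1 (-1) A.vac) := by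
  cases n with
  | ofNat n =>
    change (mulSub^[n] (comm φ.1 ψ.1)) 0 (-1) A.vac = _
    obtain ⟨χ, hχ⟩ : ∃ χ : ℤ → ℤ → Module.End K V, χ = fun m k => φ.1 m * ψ.1 k := ⟨_, rfl⟩
    obtain ⟨ω, hω⟩ : ∃ ω : ℤ → ℤ → Module.End K V, ω = fun m k => ψ.1 k * φ.1 m := ⟨_, rfl⟩
    have hsub : ∀ (N : ℕ) (F G : ℤ → ℤ → Module.End K V),
        mulSub^[N] (F - G) = mulSub^[N] F - mulSub^[N] G := by
      intro N
      induction N with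
      | zero => intro F G; rfl
      | succ N ih =>
        intro F G
        simp only [Function.iterate_succ_apply]
        rw [← ih]
        congr 1
        funext m k
        simp only [mulSub, Pi.sub_apply]
        abel
    have hvan : ∀ (N : ℕ) (F : ℤ → ℤ → Module.End K V),
        (∀ m k : ℤ, 0 ≤ m → F m k A.vac = 0) →
        ∀ m k : ℤ, 0 ≤ m → (mulSub^[N] F) m k A.vac = 0 := by
      intro N
      induction N with
      | zero => intro F hF; exact hF
      | succ N ih =>
        intro F hF
        rw [Function.iterate_succ_apply]
        refine ih _ fun m k hm => ?_
        simp [mulSub, hF m (k + 1) hm, hF (m + 1) k (by omega)]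
    have hc : comm φ.1 ψ.1 = χ - ω := by rw [hχ, hω]; rfl
    rw [hc, hsub]
    simp only [Pi.sub_apply, LinearMap.sub_apply]
    rw [hvan n ω (fun m k hm => by simp [hω, A.vacuum φ hφ m hm]) 0 (-1) le_rfl,
      iterate_mulSub_vac (fun m k hk => by simp [hχ, A.vacuum ψ hψ k hk])]
    simp [hχ]
  | negSucc m =>
    have hd := A.hderiv_mem hφ m
    change (∑' k : ℕ, (hderiv m φ).1 (-1 - k) (ψ.1 (-1 + k) A.vac)) +
      ∑' k : ℕ, ψ.1 (-1 - 1 - k) ((hderiv m φ).1 k A.vac) = _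
    rw [tsum_eq_single 0]
    · have h0 : ∀ k : ℕ, ψ.1 (-1 - 1 - k) ((hderiv m φ).1 k A.vac) = 0 := fun k => by
        rw [A.vacuum _ hd k (by omega), map_zero]
      simp only [h0, tsum_zero, add_zero, Nat.cast_zero, sub_zero]
      rw [hderiv_apply_neg_one, Int.negSucc_eq]
      congr 2
      ring_nf
    · intro k hk
      rw [A.vacuum ψ hψ (-1 + k) (by omega), map_zero]

/-- `a_(n) b` for `a, b ∈ V'`; it lies in `V'`. -/
noncomputable def mode (a : A.states) (n : ℤ) (b : A.states) : A.states :=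
  ⟨(A.Y a).1.1 n b,
    ⟨⟨nthProd (A.Y a).1 (A.Y b).1 n, A.nthProd_mem _ (A.Y a).2 _ (A.Y b).2 n⟩, by
      change (nthProd (A.Y a).1 (A.Y b).1 n).1 (-1) A.vac = _
      rw [A.nthProd_vac (A.Y a).2 (A.Y b).2, A.fs_Y]⟩⟩

/-! ### Formal series

Below, an element `∑ f_k z^k` of `M[[z^±1]]` is the function `k ↦ f_k` (`k` is the exponent of `z`),
and an element `∑ F_{q,p} w^q z^p` (`q ≥ 0`) of `M[[z^±1]][[w]]` is the function `q ↦ p ↦ F_{q,p}`. -/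

/-- The series `Y(a,z)b`; its coefficient at `z^k` is `a_(-k-1) b`. -/
noncomputable def YSeries (a b : A.states) : ℤ → A.states := fun k => A.mode a (-k - 1) b

/-- The series `e^{-wT} b = ∑ (-w)^q T^(q) b`. -/
noncomputable def expNeg (b : A.states) : ℕ → A.states := fun q => (-1 : ℤ) ^ q • A.divT q b

/-- The action of `e^{wT} = ∑ w^j T^(j)` on `V'[[z^±1]][[w]]`. -/
noncomputable def expAct (F : ℕ → ℤ → A.states) : ℕ → ℤ → A.states :=
  fun q p => ∑ x ∈ Finset.HasAntidiagonal.antidiagonal q, A.divT x.1 (F x.2 p)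

/-- The series `e^{wT} Y(a,z) e^{-wT} b`. -/
noncomputable def conjExp (a b : A.states) : ℕ → ℤ → A.states :=
  A.expAct fun q => A.YSeries a (A.expNeg b q)

/-- `G(z) = e^{zT} F(z)` for `F ∈ V'[[z^±1]]`, `G ∈ V[[z^±1]]`: for every `k`, the coefficient of `G`
at `z^k` is the sum of the convergent series `∑_{m ≥ 0} T^(m) F_{k-m}` in `V`. -/
def IsExpMul (F : ℤ → A.states) (G : ℤ → V) : Prop :=
  ∀ k : ℤ, HasSum (fun m : ℕ => (A.divT m (F (k - m)) : V)) (G k)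

end VertexAlgebra

/-- The expansion `i_{z,w} ((z+w)^k) = ∑_{q ≥ 0} binom(k,q) z^(k-q) w^q`, `k ∈ ℤ`, in the domain
`|z| > |w|`: its coefficient at `w^q z^p`. -/
def expandPow (k : ℤ) (q : ℕ) (p : ℤ) : ℤ := if p = k - q then Ring.choose k q else 0

/-- `i_{z,w} f(z+w) = ∑_k f_k i_{z,w} ((z+w)^k)` for `f(z) = ∑_k f_k z^k`
(every monomial `w^q z^p` occurs in at most one of the summands). -/
noncomputable def expandShift {M : Type*} [AddCommGroup M] (f : ℤ → M) (q : ℕ) (p : ℤ) : M :=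
  ∑ᶠ k : ℤ, expandPow k q p • f k

/-- The series `f(-z)`. -/
def negArg {M : Type*} [AddCommGroup M] (f : ℤ → M) : ℤ → M := fun k => ((-1 : ℤˣ) ^ k : ℤˣ) • f k

end NAVertex

/-! Part (a) exponentiates covariance. Left and right multiplication by `T` commute, so the binomial
theorem expands the powers of `[T, ·]`, while covariance turns `[T, ·]^q` into `q! ∂^(q)`
(`IsCovariant.adT_pow`). Torsion-freeness of `V` cancels the factorial.

Part (c) reads off one coefficient of `(z-w)^N [Y(a,z), Y(b,w)]|0⟩`, the one at `z^(M-1) w^0`, with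
`N = n + M`. In the product `Y(a,z)Y(b,w)|0⟩` no negative power of `w` occurs, so only `z^N` matters
and the coefficient is `a_(n) b`. In the product `Y(b,w)Y(a,z)|0⟩`, on which `T` acts as `∂_z +
∂_w`, it is exactly the `M`-th partial sum of the series (`iterate_mulSub_opMul_eq_sum`). The
difference is thus a coefficient that locality makes small, uniformly in its position, as `M → ∞`
(`mode_sub_sum_skewTerm`). Part (b) is (c) reindexed.

For (d), locality sends the terms to `0` in the supremum norm, so the series of fields converges.
Its sum lies in the closed submodule `Fld(V)` and has by (c) the same state as `a(z)_(n) b(z)`;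
injectivity of `fs` concludes. -/

namespace NAVertex

/-! ### Powers of `[T, ·]`, and multiplication by `(z-w)^N` -/

section Covariance

set_option linter.unusedSectionVars false

variable {K V : Type*} [NormedCommRing K] [IsUltrametricDist K] [CompleteSpace K]
  [NormedAddCommGroup V] [IsUltrametricDist V] [CompleteSpace V] [Module K V] [IsBoundedSMul K V]

/-- The derivation `X ↦ [T, X]` of `End(V)`. -/
def adT (T : Module.End K V) : Module.End ℤ (Module.End K V) :=
  LinearMap.mulLeft ℤ T - LinearMap.mulRight ℤ T

theorem adT_apply (T X : Module.End K V) : adT T X = T * X - X * T := rfl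

theorem mulLeft_pow_apply (T X : Module.End K V) (n : ℕ) :
    (LinearMap.mulLeft ℤ T ^ n) X = T ^ n * X := by
  rw [LinearMap.pow_mulLeft, LinearMap.mulLeft_apply]

theorem mulRight_pow_apply (T X : Module.End K V) (n : ℕ) :
    (LinearMap.mulRight ℤ T ^ n) X = X * T ^ n := by
  rw [LinearMap.pow_mulRight, LinearMap.mulRight_apply]

/-- The divided powers of `[T, ·]` act on a covariant field as the operators `∂_z^(q)`. -/
theorem IsCovariant.adT_pow {T : Module.End K V} {φ : QField K V} (h : IsCovariant T φ)
    (q : ℕ) (n : ℤ) :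
    (adT T ^ q) (φ.1 n) = ((q.factorial : ℤ) * Ring.choose ((q : ℤ) - n - 1) q) • φ.1 (n - q) := by
  induction q with
  | zero => simp
  | succ q ih =>
    have h1 := h (n - q)
    have h2 : (hderiv 1 φ).1 (n - q) = ((q : ℤ) - n) • φ.1 (n - (q + 1 : ℕ)) := by
      simp only [hderiv, Nat.cast_one, Ring.choose_one_right]
      rw [show ((1 : ℤ) - (n - q) - 1) = q - n by ring,
        show n - q - 1 = n - (q + 1 : ℕ) by push_cast; ring]
    -- The absorption identity `(q+1) binom(r+1, q+1) = (r+1) binom(r, q)` with `r = q - n - 1`.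
    have h3 := Ring.choose_add_smul_choose ((q : ℤ) - n - 1) q 1
    rw [Nat.cast_one, Ring.choose_one_right, Nat.choose_one_right] at h3
    simp only [nsmul_eq_mul, sub_add_cancel] at h3
    have h4 : ((q + 1 : ℕ) : ℤ) - n - 1 = q - n := by push_cast; ring
    rw [pow_succ', Module.End.mul_apply, ih, map_zsmul, adT_apply, h1, h2, smul_smul, h4,
      Nat.factorial_succ]
    congr 1
    push_cast at h3 ⊢
    linear_combination -(q.factorial : ℤ) * h3

theorem neg_pow_apply {M : Type*} [AddCommGroup M] (f : Module.End ℤ M) (n : ℕ) (x : M) :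
    ((-f) ^ n) x = (-1 : ℤ) ^ n • (f ^ n) x := by
  rcases Nat.even_or_odd n with h | h <;> simp [h.neg_pow]

theorem adT_pow_eq_sum (T X : Module.End K V) (q : ℕ) :
    (adT T ^ q) X = ∑ x ∈ Finset.HasAntidiagonal.antidiagonal q,
      (q.choose x.1 : ℤ) • (-1 : ℤ) ^ x.2 • (T ^ x.1 * X * T ^ x.2) := by
  have hc : Commute (LinearMap.mulLeft ℤ T) (-LinearMap.mulRight ℤ T) :=
    (LinearMap.commute_mulLeft_right T T).neg_right
  rw [adT, sub_eq_add_neg, hc.add_pow', LinearMap.sum_apply]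
  refine Finset.sum_congr rfl fun x _ => ?_
  rw [LinearMap.smul_apply, natCast_zsmul, Module.End.mul_apply, mulLeft_pow_apply, neg_pow_apply,
    mulRight_pow_apply, mul_smul_comm, mul_assoc]

/-- Right multiplication by `T` is left multiplication minus `[T, ·]`, and these two commute. This
form moves powers of `T` to the left of a mode. -/
theorem mul_pow_eq_sum_adT (T X : Module.End K V) (q : ℕ) :
    X * T ^ q = ∑ x ∈ Finset.HasAntidiagonal.antidiagonal q,
      (q.choose x.1 : ℤ) • (-1 : ℤ) ^ x.2 • (T ^ x.1 * (adT T ^ x.2) X) := by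
  have hc : Commute (LinearMap.mulLeft ℤ T) (-adT T) :=
    ((Commute.refl _).sub_right (LinearMap.commute_mulLeft_right T T)).neg_right
  have h : LinearMap.mulRight ℤ T = LinearMap.mulLeft ℤ T + -adT T := by rw [adT]; abel
  rw [← mulRight_pow_apply, h, hc.add_pow', LinearMap.sum_apply]
  refine Finset.sum_congr rfl fun x _ => ?_
  rw [LinearMap.smul_apply, natCast_zsmul, Module.End.mul_apply, mulLeft_pow_apply, neg_pow_apply,
    mul_smul_comm]

/-- If `T` acts on `F(z,w)` as `∂_z + ∂_w`, then it acts so on `(z-w)^N F(z,w)`. -/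
theorem iterate_mulSub_covariant {F : ℤ → ℤ → Module.End K V} {T : Module.End K V} {x : V}
    (hF : ∀ m k, T (F m k x) = (-m) • F (m - 1) k x + (-k) • F m (k - 1) x) (N : ℕ) :
    ∀ m k, T ((mulSub^[N] F) m k x) =
      (-m) • (mulSub^[N] F) (m - 1) k x + (-k) • (mulSub^[N] F) m (k - 1) x := by
  induction N generalizing F with
  | zero => simpa using hF
  | succ N ih =>
    rw [Function.iterate_succ_apply]
    refine ih fun m k => ?_
    simp only [mulSub, LinearMap.sub_apply, map_sub, hF, add_sub_cancel_right, sub_add_cancel]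
    module

/-- Index `m ≥ 0` is a negative power of `z`. At `z^0` a factor `z` would have to meet the absent
`z^(-1)`, so `(z-w)^N` acts there as `(-w)^N`. -/
theorem iterate_mulSub_vanish {F : ℤ → ℤ → Module.End K V} {x : V}
    (hF : ∀ m k, 0 ≤ m → F m k x = 0) (N : ℕ) :
    (∀ m k, 0 ≤ m → (mulSub^[N] F) m k x = 0) ∧
      ∀ k, (mulSub^[N] F) (-1) k x = (-1 : ℤ) ^ N • F (-1) (k + N) x := by
  induction N generalizing F with
  | zero => simpa using hF
  | succ N ih =>
    rw [Function.iterate_succ_apply]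
    have h : ∀ m k, 0 ≤ m → mulSub F m k x = 0 := fun m k hm => by
      simp [mulSub, hF m (k + 1) hm, hF (m + 1) k (by omega)]
    refine ⟨(ih h).1, fun k => ?_⟩
    rw [(ih h).2]
    simp only [mulSub, LinearMap.sub_apply, neg_add_cancel, hF 0 _ le_rfl, zero_sub, pow_succ,
      mul_neg_one, neg_smul, smul_neg]
    push_cast
    rw [add_assoc]

theorem iterate_mulSub_sub (N : ℕ) (F G : ℤ → ℤ → Module.End K V) :
    mulSub^[N] (F - G) = mulSub^[N] F - mulSub^[N] G := by
  induction N generalizing F G with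
  | zero => rfl
  | succ N ih =>
    simp only [Function.iterate_succ_apply]
    rw [← ih]
    congr 1
    funext m k
    simp only [mulSub, Pi.sub_apply]
    abel

end Covariance

/-! ### Convergence of series of fields -/

section Completeness

set_option linter.unusedSectionVars false

variable {K V : Type*} [NormedCommRing K] [IsUltrametricDist K] [CompleteSpace K]
  [NormedAddCommGroup V] [IsUltrametricDist V] [CompleteSpace V] [Module K V] [IsBoundedSMul K V]

theorem NormLE.hderiv {φ : QField K V} {C : ℝ} (h : NormLE φ.1 C) (m : ℕ) :
    NormLE (hderiv m φ).1 C :=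
  fun _ v => (norm_zsmul_le_self _ _).trans (h _ v)

theorem norm_units_smul (u : ℤˣ) (v : V) : ‖u • v‖ = ‖v‖ := by
  rcases Int.units_eq_one_or u with rfl | rfl <;> simp [Units.smul_def]

/-- A series of fields whose terms tend to `0` in the supremum norm converges. -/
theorem exists_fieldHasSum {f : ℕ → QField K V}
    (hf : ∀ ε > 0, ∃ M₀ : ℕ, ∀ m ≥ M₀, NormLE (f m).1 ε) : ∃ g, FieldHasSum f g := by
  have hs : ∀ n v, Summable fun m => (f m).1 n v := by
    intro n v
    apply summable_of_tendsto
    rw [NormedAddGroup.tendsto_nhds_zero]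
    intro ε hε
    obtain ⟨M, hM⟩ := hf (ε / (‖v‖ + 1)) (by positivity)
    filter_upwards [eventually_ge_atTop M] with m hm
    refine (hM m hm n v).trans_lt ?_
    rw [div_mul_eq_mul_div, div_lt_iff₀ (by positivity)]
    nlinarith
  -- By the ultrametric inequality a tail is bounded by its largest term, so the estimate is uniform
  -- in the mode `n`.
  have htail : ∀ ε > 0, ∃ M₀ : ℕ, ∀ M ≥ M₀, ∀ n v,
      ‖(∑' m, (f m).1 n v) - ∑ m ∈ Finset.range M, (f m).1 n v‖ ≤ ε * ‖v‖ := by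
    intro ε hε
    obtain ⟨M₀, hM₀⟩ := hf ε hε
    refine ⟨M₀, fun M hM n v => ?_⟩
    rw [← (hs n v).sum_add_tsum_nat_add M, add_sub_cancel_left]
    exact norm_tsum_le_of_le fun k => hM₀ _ (by omega) n v
  have hsum : ∀ M n v, (∑ m ∈ Finset.range M, f m).1 n v = ∑ m ∈ Finset.range M, (f m).1 n v := by
    intro M n v
    simp [Finset.sum_apply]
  refine ⟨⟨fun n =>
    { toFun := fun v => ∑' m, (f m).1 n v
      map_add' := fun u v => by
        simp only [map_add]
        exact (hs n u).tsum_add (hs n v)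
      map_smul' := fun c v => by
        simp only [map_smul, RingHom.id_apply]
        exact (hs n v).tsum_const_smul c }, ?_, ?_⟩, ?_⟩
  -- The sum is within distance `1` of a partial sum, which is bounded.
  · obtain ⟨M, hM⟩ := htail 1 one_pos
    obtain ⟨C, hC0, hC⟩ := exists_bound (∑ m ∈ Finset.range M, f m)
    refine ⟨1 + C, fun n v => ?_⟩
    change ‖∑' m, (f m).1 n v‖ ≤ _
    rw [← sub_add_cancel (∑' m, (f m).1 n v) (∑ m ∈ Finset.range M, (f m).1 n v), add_mul]
    refine (norm_add_le _ _).trans (add_le_add (hM M le_rfl n v) ?_)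
    rw [← hsum]
    exact hC n v
  · intro v
    change Tendsto (fun n => ∑' m, (f m).1 n v) atTop (𝓝 0)
    rw [NormedAddGroup.tendsto_nhds_zero]
    intro ε hε
    obtain ⟨M, hM⟩ := htail (ε / 2 / (‖v‖ + 1)) (by positivity)
    have h1 := NormedAddGroup.tendsto_nhds_zero.1
      (field_tendsto (∑ m ∈ Finset.range M, f m) v) (ε / 2) (by positivity)
    filter_upwards [h1] with n hn
    rw [hsum] at hn
    have h2 : ε / 2 / (‖v‖ + 1) * ‖v‖ ≤ ε / 2 := by
      rw [div_mul_eq_mul_div, div_le_iff₀ (by positivity)]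
      nlinarith
    have h3 := norm_add_le ((∑' m, (f m).1 n v) - ∑ m ∈ Finset.range M, (f m).1 n v)
      (∑ m ∈ Finset.range M, (f m).1 n v)
    rw [sub_add_cancel] at h3
    linarith [hM M le_rfl n v]
  · intro ε hε
    obtain ⟨M₀, hM₀⟩ := htail ε hε
    refine ⟨M₀, fun M hM n v => ?_⟩
    change ‖(∑' m, (f m).1 n v) - (∑ m ∈ Finset.range M, f m).1 n v‖ ≤ _
    rw [hsum]
    exact hM₀ M hM n v

end Completeness
end NAVertex

/-! ### Conjugation by `e^{wT}` on states -/

namespace NAVertex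
namespace VertexAlgebra

set_option linter.unusedSectionVars false

variable {K V : Type*} [NormedCommRing K] [IsUltrametricDist K] [CompleteSpace K]
  [IsAddTorsionFree K] [NormedAddCommGroup V] [IsUltrametricDist V] [CompleteSpace V]
  [Module K V] [IsBoundedSMul K V] [IsAddTorsionFree V] (A : VertexAlgebra K V)

theorem nsmul_factorial_cancel {m : ℕ} {x y : V} (h : m.factorial • x = m.factorial • y) : x = y :=
  IsAddTorsionFree.nsmul_right_injective (Nat.factorial_ne_zero m) h

theorem coe_divT (m : ℕ) (a : A.states) :
    (A.divT m a : V) = (A.Y a).1.1 (-(m : ℤ) - 1) A.vac := rfl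

theorem coe_mode (a : A.states) (n : ℤ) (b : A.states) :
    (A.mode a n b : V) = (A.Y a).1.1 n b := rfl

/-- The coefficients of `e^{wT} Y(a,z) e^{-wT} b`. -/
theorem sum_divT_mode_divT (a b : A.states) (n : ℤ) (q : ℕ) :
    ∑ x ∈ Finset.HasAntidiagonal.antidiagonal q,
      A.divT x.1 (A.mode a n ((-1 : ℤ) ^ x.2 • A.divT x.2 b)) =
    Ring.choose ((q : ℤ) - n - 1) q • A.mode a (n - q) b := by
  apply Subtype.ext
  apply nsmul_factorial_cancel (m := q)
  have h := LinearMap.congr_fun ((A.covariant _ (A.Y a).2).adT_pow q n) (b : V)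
  rw [LinearMap.smul_apply, mul_smul, natCast_zsmul] at h
  rw [Submodule.coe_smul_of_tower, coe_mode, ← h, adT_pow_eq_sum, LinearMap.sum_apply,
    AddSubmonoidClass.coe_finsetSum, Finset.smul_sum]
  refine Finset.sum_congr rfl fun x hx => ?_
  have hx' := Finset.HasAntidiagonal.mem_antidiagonal.1 hx
  -- The binomial coefficient comes from the expansion; the two remaining factorials turn `T^(i)`
  -- and `T^(j)` into powers of `T`.
  have hf : q.factorial = q.choose x.1 * x.2.factorial * x.1.factorial := by
    rw [← hx', mul_right_comm, Nat.choose_symm_add, Nat.add_choose_mul_factorial_mul_factorial]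
  rw [hf, mul_smul, mul_smul, factorial_smul_divT, coe_mode, Submodule.coe_smul_of_tower, map_zsmul,
    map_zsmul, smul_comm x.2.factorial, ← map_nsmul, ← map_nsmul, factorial_smul_divT,
    LinearMap.smul_apply, LinearMap.smul_apply, natCast_zsmul]
  rfl

theorem conjExp_eq_expandShift (a b : A.states) :
    A.conjExp a b = expandShift (A.YSeries a b) := by
  funext q p
  have h := A.sum_divT_mode_divT a b (-p - 1) q
  -- Only `(z+w)^(p+q)` contributes to `w^q z^p`.
  rw [expandShift, finsum_eq_single _ (p + q)]
  · refine h.trans ?_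
    rw [expandPow, if_pos (by ring), YSeries]
    congr 2 <;> ring
  · intro k hk
    rw [expandPow, if_neg (by omega), zero_smul]

/-! ### Skew-symmetry for states -/

/-- `Y(b,z) e^{wT} a = e^{wT} Y(b,z-w) a` at `z^0 w^j`. -/
theorem mode_neg_one_divT (a b : A.states) (j : ℕ) :
    (A.mode b (-1) (A.divT j a) : V) = ∑ x ∈ Finset.HasAntidiagonal.antidiagonal j,
      (-1 : ℤ) ^ x.2 • (A.divT x.1 (A.mode b (-1 - x.2) a) : V) := by
  apply nsmul_factorial_cancel (m := j)
  rw [coe_mode, ← map_nsmul, factorial_smul_divT, ← Module.End.mul_apply, mul_pow_eq_sum_adT,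
    LinearMap.sum_apply, Finset.smul_sum]
  refine Finset.sum_congr rfl fun x hx => ?_
  have hx' := Finset.HasAntidiagonal.mem_antidiagonal.1 hx
  have hf : j.factorial = j.choose x.1 * x.2.factorial * x.1.factorial := by
    rw [← hx', mul_right_comm, Nat.choose_symm_add, Nat.add_choose_mul_factorial_mul_factorial]
  -- At `z^0` the binomial coefficient in `∂_z^(r)` is `binom(r, r)`.
  have hc : Ring.choose ((x.2 : ℤ) - (-1) - 1) x.2 = 1 := by
    rw [show ((x.2 : ℤ) - (-1) - 1) = (x.2 : ℕ) by ring, Ring.choose_natCast, Nat.choose_self,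
      Nat.cast_one]
  rw [(A.covariant _ (A.Y b).2).adT_pow, hc, mul_one, smul_comm j.factorial, hf, mul_smul, mul_smul,
    factorial_smul_divT, LinearMap.smul_apply, LinearMap.smul_apply, Module.End.mul_apply,
    LinearMap.smul_apply, map_zsmul, natCast_zsmul, natCast_zsmul, smul_comm, coe_mode]

/-- The coefficients of `Y(b,w)Y(a,z)|0⟩` in `z`, `w`. -/
def opMul (φ ψ : ℤ → Module.End K V) : ℤ → ℤ → Module.End K V := fun m k => ψ k * φ m

/-- Leibniz rule together with `T|0⟩ = 0`: `T` acts as `∂_z + ∂_w`, as `iterate_mulSub_covariant`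
requires. -/
theorem T_opMul_vac (φ ψ : A.Fld) (m k : ℤ) :
    A.T (opMul φ.1.1 ψ.1.1 m k A.vac) =
      (-m) • opMul φ.1.1 ψ.1.1 (m - 1) k A.vac + (-k) • opMul φ.1.1 ψ.1.1 m (k - 1) A.vac := by
  have h := LinearMap.congr_fun (A.covariant ψ.1 ψ.2 k) (φ.1.1 m A.vac)
  simp only [LinearMap.sub_apply, Module.End.mul_apply, hderiv, Ring.choose_one_right,
    A.T_mode_vac, LinearMap.smul_apply, map_zsmul, sub_eq_iff_eq_add, Nat.cast_one] at h
  rw [opMul, Module.End.mul_apply, h, add_comm, show (1 : ℤ) - k - 1 = -k by ring]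
  rfl

/-- The coefficient of `(z-w)^N Y(b,w)Y(a,z)|0⟩` at `z^j w^(-1)`. -/
theorem iterate_mulSub_opMul_zero (a b : A.states) (N j : ℕ) :
    (mulSub^[N] (opMul (A.Y a).1.1 (A.Y b).1.1)) (-(j : ℤ) - 1) 0 A.vac =
      (-1 : ℤ) ^ N • (A.divT j (A.mode b N a) : V) := by
  have hv := (iterate_mulSub_vanish (F := opMul (A.Y a).1.1 (A.Y b).1.1) (x := A.vac)
    (fun m k hm => by simp [opMul, A.vacuum _ (A.Y a).2 m hm]) N).2 0
  have hT := iterate_mulSub_covariant (A.T_opMul_vac (A.Y a) (A.Y b)) N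
  apply nsmul_factorial_cancel (m := j)
  rw [smul_comm, factorial_smul_divT]
  have hb : (-1 : ℤ) ^ N • (A.mode b N a : V) =
      (mulSub^[N] (opMul (A.Y a).1.1 (A.Y b).1.1)) (-1) 0 A.vac := by
    rw [hv, zero_add, coe_mode, opMul, Module.End.mul_apply, A.fs_Y]
  rw [← map_zsmul, hb]
  -- Since `∂_w` never produces `w^(-1)`, `T` acts on this coefficient as `∂_z` alone, so the
  -- coefficient at `z^0` determines those at all `z^j`.
  induction j with
  | zero => simp
  | succ j ih =>
    rw [pow_succ', Module.End.mul_apply, ← ih, map_nsmul, hT, Nat.factorial_succ, neg_zero,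
      zero_smul, add_zero, mul_comm, mul_smul,
      show -(-(j : ℤ) - 1) = ((j + 1 : ℕ) : ℤ) by push_cast; ring, natCast_zsmul,
      show -((j + 1 : ℕ) : ℤ) - 1 = -(j : ℤ) - 1 - 1 by push_cast; ring]

/-- The terms of the skew-symmetry formula. -/
noncomputable def skewTerm (a b : A.states) (n : ℤ) (m : ℕ) : V :=
  -(((-1 : ℤˣ) ^ ((m : ℤ) + n) : ℤˣ) • (A.divT m (A.mode b (m + n) a) : V))

/-- `M` and `N` descend together with `N - M = n` fixed. Each factor `z - w` removed splits off one
term of the series, until either `M = 0` or `N = 0`. -/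
theorem iterate_mulSub_opMul_eq_sum (a b : A.states) (n : ℤ) (N M : ℕ) (h : (N : ℤ) = n + M) :
    (mulSub^[N] (opMul (A.Y a).1.1 (A.Y b).1.1)) (-(M : ℤ)) (-1) A.vac =
      ∑ m ∈ Finset.range M, A.skewTerm a b n m := by
  induction M generalizing N with
  | zero =>
    rw [Finset.range_zero, Finset.sum_empty]
    -- For `M = 0` the coefficient sits at `z^(-1)`, where nothing occurs.
    exact (iterate_mulSub_vanish
      (fun m k hm => by simp [opMul, A.vacuum _ (A.Y a).2 m hm]) N).1 _ _ (by simp)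
  | succ M ih =>
    cases N with
    | zero =>
      -- With no factor `z - w` left, the coefficient is `b_(-1) T^(M) a`. Commuting `T^(M)` to the
      -- left yields all remaining terms at once.
      have h0 := A.mode_neg_one_divT a b M
      rw [Finset.Nat.sum_antidiagonal_eq_sum_range_succ
        (fun i j => (-1 : ℤ) ^ j • (A.divT i (A.mode b (-1 - j) a) : V)) M] at h0
      rw [Function.iterate_zero, id, opMul, Module.End.mul_apply,
        show -((M + 1 : ℕ) : ℤ) = -(M : ℤ) - 1 by push_cast; ring, ← coe_divT, ← coe_mode, h0]
      refine Finset.sum_congr rfl fun m hm => ?_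
      have hm' := Finset.mem_range.1 hm
      obtain ⟨r, rfl⟩ : ∃ r, M = m + r := ⟨M - m, by omega⟩
      obtain rfl : n = -(m : ℤ) - r - 1 := by push_cast at h; omega
      rw [skewTerm, Nat.add_sub_cancel_left,
        show (m : ℤ) + (-(m : ℤ) - r - 1) = -((r + 1 : ℕ) : ℤ) by push_cast; ring, zpow_neg,
        zpow_natCast, Int.units_inv_eq_self, pow_succ, Units.smul_def,
        show (-1 : ℤ) - r = -((r + 1 : ℕ) : ℤ) by push_cast; ring]
      simp
    | succ N =>
      -- The factor `z` gives the induction hypothesis; the factor `-w` gives the coefficient at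
      -- `z^M w^(-1)`, which is the new term.
      rw [Function.iterate_succ_apply', mulSub, LinearMap.sub_apply, Finset.sum_range_succ,
        show -((M + 1 : ℕ) : ℤ) + 1 = -(M : ℤ) by push_cast; ring,
        ih N (by push_cast at h; omega), sub_eq_add_neg, neg_add_cancel,
        show -((M + 1 : ℕ) : ℤ) = -(M : ℤ) - 1 by push_cast; ring, iterate_mulSub_opMul_zero,
        skewTerm, show (M : ℤ) + n = (N : ℕ) by push_cast at h; omega, zpow_natCast, Units.smul_def]
      simp

/-- The partial sums of the skew-symmetry formula are controlled by locality. -/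
theorem mode_sub_sum_skewTerm (a b : A.states) (n : ℤ) (N M : ℕ) (h : (N : ℤ) = n + M) :
    (A.mode a n b : V) - ∑ m ∈ Finset.range M, A.skewTerm a b n m =
      (mulSub^[N] (comm (A.Y a).1.1 (A.Y b).1.1)) (-(M : ℤ)) (-1) A.vac := by
  have hc : comm (A.Y a).1.1 (A.Y b).1.1 =
      (fun m k => (A.Y a).1.1 m * (A.Y b).1.1 k) - opMul (A.Y a).1.1 (A.Y b).1.1 := rfl
  -- In `Y(a,z)Y(b,w)|0⟩` at `w^0` only `z^N` acts, shifting the mode index from `-M` to `N - M =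
  -- n`.
  rw [hc, iterate_mulSub_sub, Pi.sub_apply, Pi.sub_apply, LinearMap.sub_apply,
    iterate_mulSub_opMul_eq_sum A a b n N M h,
    iterate_mulSub_vac fun m k hk => by simp [A.vacuum _ (A.Y b).2 k hk],
    show -(M : ℤ) + N = n by omega, Module.End.mul_apply, A.fs_Y, coe_mode]

theorem tendsto_sum_skewTerm (a b : A.states) (n : ℤ) :
    Tendsto (fun M => ∑ m ∈ Finset.range M, A.skewTerm a b n m) atTop (𝓝 (A.mode a n b : V)) := by
  rw [tendsto_iff_norm_sub_tendsto_zero, Metric.tendsto_atTop]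
  intro ε hε
  obtain ⟨N₀, hN₀⟩ := A.locality _ (A.Y a).2 _ (A.Y b).2 (ε / (‖A.vac‖ + 1)) (by positivity)
  -- This ensures `n + M ≥ N₀ ≥ 0`, so that `toNat` loses nothing. The coefficient examined moves
  -- with `M`, but locality bounds all coefficients at once.
  refine ⟨N₀ + n.natAbs, fun M hM => ?_⟩
  have h := hN₀ (n + M).toNat (by omega) (-(M : ℤ), -1) A.vac
  rw [← A.mode_sub_sum_skewTerm a b n _ M (by omega), norm_sub_rev] at h
  rw [dist_zero_right, norm_norm]
  refine h.trans_lt ?_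
  rw [div_mul_eq_mul_div, div_lt_iff₀ (by positivity)]
  nlinarith

/-! ### Skew-symmetry for fields -/

/-- The terms of the skew-symmetry formula for fields. -/
noncomputable def skewField (φ ψ : QField K V) (n : ℤ) (m : ℕ) : QField K V :=
  -(((-1 : ℤˣ) ^ ((m : ℤ) + n) : ℤˣ) • hderiv m (nthProd ψ φ (m + n)))

theorem skewField_apply (φ ψ : QField K V) (n : ℤ) (m : ℕ) (p : ℤ) (v : V) :
    (skewField φ ψ n m).1 p v =
      -(((-1 : ℤˣ) ^ ((m : ℤ) + n) : ℤˣ) • (hderiv m (nthProd ψ φ (m + n))).1 p v) := rfl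

theorem skewField_mem {φ ψ : QField K V} (hφ : φ ∈ A.Fld) (hψ : ψ ∈ A.Fld) (n : ℤ) (m : ℕ) :
    skewField φ ψ n m ∈ A.Fld := by
  rw [skewField, Units.smul_def]
  exact A.Fld.neg_mem (A.Fld.toAddSubgroup.zsmul_mem
    (A.hderiv_mem (A.nthProd_mem _ hψ _ hφ _) m) _)

/-- Once `m + n ≥ 0`, the product is a residue of `(z-w)^(m+n) [b(z), a(w)]`, small by locality;
divided derivatives multiply coefficients by integers, which do not increase ultrametric norms. -/
theorem normLE_skewField {φ ψ : QField K V} (hφ : φ ∈ A.Fld) (hψ : ψ ∈ A.Fld) (n : ℤ) :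
    ∀ ε > 0, ∃ M₀ : ℕ, ∀ m ≥ M₀, NormLE (skewField φ ψ n m).1 ε := by
  intro ε hε
  obtain ⟨N₀, hN₀⟩ := A.locality ψ hψ φ hφ ε hε
  refine ⟨N₀ + n.natAbs, fun m hm p v => ?_⟩
  rw [skewField_apply, norm_neg, norm_units_smul]
  refine NormLE.hderiv (fun p v => ?_) m p v
  obtain ⟨N, hN⟩ : ∃ N : ℕ, (m : ℤ) + n = N := ⟨((m : ℤ) + n).toNat, by omega⟩
  rw [hN]
  exact hN₀ N (by omega) (0, p) v

/-- Both fields lie in `Fld(V)` and have the same state, so `fs_injective` applies. -/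
theorem Y_mode (a b : A.states) (n : ℤ) :
    (A.Y (A.mode a n b)).1 = nthProd (A.Y a).1 (A.Y b).1 n := by
  have h : A.Y (A.mode a n b) =
      ⟨nthProd (A.Y a).1 (A.Y b).1 n, A.nthProd_mem _ (A.Y a).2 _ (A.Y b).2 n⟩ := by
    apply A.fs_injective
    refine (A.fs_Y _).trans ?_
    change _ = (nthProd (A.Y a).1 (A.Y b).1 n).1 (-1) A.vac
    rw [A.nthProd_vac (A.Y a).2 (A.Y b).2, A.fs_Y, coe_mode]
  rw [h]

theorem skewField_vac (a b : A.states) (n : ℤ) (m : ℕ) :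
    (skewField (A.Y a).1 (A.Y b).1 n m).1 (-1) A.vac = A.skewTerm a b n m := by
  rw [skewField_apply, hderiv_apply_neg_one, skewTerm, coe_divT, Y_mode]

/-- Skew-symmetry for the modes. -/
theorem hasSum_skewTerm (a b : A.states) (n : ℤ) :
    HasSum (A.skewTerm a b n) (A.mode a n b : V) := by
  -- `HasSum` is unconditional, so convergence of partial sums is not enough. Terms tending to `0`
  -- give summability in a complete ultrametric group.
  have hs : Summable (A.skewTerm a b n) := by
    apply summable_of_tendsto
    rw [NormedAddGroup.tendsto_nhds_zero]
    intro ε hε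
    obtain ⟨M, hM⟩ := A.normLE_skewField (A.Y a).2 (A.Y b).2 n (ε / (‖A.vac‖ + 1)) (by positivity)
    filter_upwards [eventually_ge_atTop M] with m hm
    rw [← skewField_vac]
    refine (hM m hm (-1) A.vac).trans_lt ?_
    rw [div_mul_eq_mul_div, div_lt_iff₀ (by positivity)]
    nlinarith
  exact hs.hasSum_iff_tendsto_nat.2 (A.tendsto_sum_skewTerm a b n)

/-- The coefficient at `z^k` is the mode formula for `n = -k - 1`; the odd shift in the exponent of
`-1` accounts for the overall minus sign. -/
theorem isExpMul_YSeries (a b : A.states) :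
    A.IsExpMul (negArg (A.YSeries b a)) fun k => (A.YSeries a b k : V) := by
  intro k
  convert A.hasSum_skewTerm a b (-k - 1) using 2 with m
  swap
  · rfl
  have hs : (-1 : ℤˣ) ^ (k - m) = -(-1 : ℤˣ) ^ ((m : ℤ) + (-k - 1)) := by
    rw [← Int.units_inv_eq_self ((-1) ^ (k - (m : ℤ))), ← zpow_neg, ← mul_neg_one (_ ^ _),
      ← zpow_add_one]
    congr 1
    ring
  rw [negArg, YSeries, skewTerm, hs, show -(k - (m : ℤ)) - 1 = m + (-k - 1) by ring,
    Units.smul_def, Units.smul_def, Units.val_neg, neg_smul, map_neg, map_zsmul, NegMemClass.coe_neg,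
    Submodule.coe_smul_of_tower]

/-- Skew-symmetry for the products of fields. -/
theorem fieldHasSum_skewField {φ ψ : QField K V} (hφ : φ ∈ A.Fld) (hψ : ψ ∈ A.Fld) (n : ℤ) :
    FieldHasSum (skewField φ ψ n) (nthProd φ ψ n) := by
  obtain ⟨a, ha⟩ := A.Y.surjective ⟨φ, hφ⟩
  obtain ⟨b, hb⟩ := A.Y.surjective ⟨ψ, hψ⟩
  obtain rfl : (A.Y a).1 = φ := congrArg Subtype.val ha
  obtain rfl : (A.Y b).1 = ψ := congrArg Subtype.val hb
  obtain ⟨g, hg⟩ := exists_fieldHasSum (A.normLE_skewField hφ hψ n)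
  have hmem : g ∈ A.Fld := A.isClosed_Fld g fun ε hε => by
    obtain ⟨M, hM⟩ := hg ε hε
    exact ⟨_, A.Fld.sum_mem fun m _ => A.skewField_mem hφ hψ n m, hM M le_rfl⟩
  have hlim : Tendsto (fun M => ∑ m ∈ Finset.range M, A.skewTerm a b n m) atTop
      (𝓝 (g.1 (-1) A.vac)) := by
    rw [tendsto_iff_norm_sub_tendsto_zero, Metric.tendsto_atTop]
    intro ε hε
    obtain ⟨M₀, hM₀⟩ := hg (ε / (‖A.vac‖ + 1)) (by positivity)
    refine ⟨M₀, fun M hM => ?_⟩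
    have h1 : ∑ m ∈ Finset.range M, A.skewTerm a b n m =
        (∑ m ∈ Finset.range M, skewField (A.Y a).1 (A.Y b).1 n m).1 (-1) A.vac := by
      simp [Finset.sum_apply, skewField_vac]
    rw [dist_zero_right, norm_norm, norm_sub_rev, h1]
    refine (hM₀ M hM (-1) A.vac).trans_lt ?_
    rw [div_mul_eq_mul_div, div_lt_iff₀ (by positivity)]
    nlinarith
  -- The state of the limit field is the limit of the states of the partial sums, already known to
  -- be `a_(n) b`.
  have heq : g.1 (-1) A.vac = (nthProd (A.Y a).1 (A.Y b).1 n).1 (-1) A.vac := by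
    rw [tendsto_nhds_unique hlim (A.tendsto_sum_skewTerm a b n), A.nthProd_vac hφ hψ, coe_mode,
      A.fs_Y]
  have h := A.fs_injective (a₁ := ⟨g, hmem⟩) (a₂ := ⟨_, A.nthProd_mem _ hφ _ hψ n⟩) heq
  obtain rfl := congrArg Subtype.val h
  exact hg

end VertexAlgebra
end NAVertex

theorem mainTheorem11 {K V : Type*} [NormedCommRing K] [IsUltrametricDist K] [CompleteSpace K]
    [IsAddTorsionFree K] [NormedAddCommGroup V] [IsUltrametricDist V] [CompleteSpace V]
    [Module K V] [IsBoundedSMul K V] [IsAddTorsionFree V] (A : NAVertex.VertexAlgebra K V) :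
    (∀ a b : A.states, A.conjExp a b = NAVertex.expandShift (A.YSeries a b)) ∧
    (∀ a b : A.states,
      A.IsExpMul (NAVertex.negArg (A.YSeries b a)) (fun k => (A.YSeries a b k : V))) ∧
    (∀ (a b : A.states) (n : ℤ),
      HasSum (fun m : ℕ => -(((-1 : ℤˣ) ^ ((m : ℤ) + n) : ℤˣ) •
        (A.divT m (A.mode b (m + n) a) : V))) (A.mode a n b : V)) ∧
    (∀ a ∈ A.Fld, ∀ b ∈ A.Fld, ∀ n : ℤ,
      NAVertex.FieldHasSum (fun m : ℕ => -(((-1 : ℤˣ) ^ ((m : ℤ) + n) : ℤˣ) •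
        NAVertex.hderiv m (NAVertex.nthProd b a (m + n)))) (NAVertex.nthProd a b n)) := by
  exact ⟨A.conjExp_eq_expandShift, A.isExpMul_YSeries, A.hasSum_skewTerm,
    fun _ ha _ hb n => A.fieldHasSum_skewField ha hb n⟩
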